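/- Let $A$ be a unital commutative $\mathbb{R}$-algebra generated by a linear subspace $V\subseteq A$. Let $X(A)$ be its character space, i.e. the set of all unital $\mathbb{R}$-algebra homomorphisms $A\to\mathbb{R}$, with the weakest topology making all evaluations $\hat a\colon\alpha\mapsto\alpha(a)$ ($a\in A$) continuous and with the Borel $\sigma$-algebra of this topology; use the same conventions for subalgebras of $A$. Let $J:=\{\langle W\rangle : W \text{ a finite dimensional subspace of } V\}$, where $\langle W\rangle$ is the (unital) subalgebra of $A$ generated by $W$. Let $Q\subseteq A$ be a quadratic module, i.e. $1\in Q$, $Q+Q\subseteq Q$ and $a^2Q\subseteq Q$ for all $a\in A$, and let $K\subseteq X(A)$ be closed with $K=K_Q:=\{\alpha\in X(A):\alpha(a)\ge 0\ \text{for all } a\in Q\}$. For a subalgebra $S$ of $A$ put $K_{Q\cap S}:=\{\alpha\in X(S):\alpha(a)\ge 0\ \text{for all } a\in Q\cap S\}$. Let $L\colon A\to\mathbb{R}$ be linear with $L(1)=1$ and $L(a)\ge 0$ for every finite sum of squares $a$ in $A$, and let $s_L$ be the seminorm $s_L(a):=\sqrt{L(a^2)}$ on $A$. A seminorm $q$ on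 $V$ is Hilbertian if $q(v)=\sqrt{\langle v,v\rangle}$ for a symmetric positive semidefinite bilinear form on $V$, denoted $\langle\cdot,\cdot\rangle_q$ (it is determined by $q$). For Hilbertian seminorms $p,q$ on $V$, $\mathrm{tr}(p/q)\in[0,\infty]$ is the supremum of $\sum_{e\in E}p(e)^2$ over all finite $q$-orthonormal sets $E\subseteq V$ if $\ker q\subseteq\ker p$, and $\infty$ otherwise. A linear functional $\ell$ on $V$ is $q$-continuous if there is $C>0$ with $|\ell(v)|\le C\,q(v)$ for all $v\in V$. A Radon measure is a non-negative Borel measure that is locally finite and inner regular with respect to compact sets. For a subalgebra $S$ of $A$ (possibly $S=A$), a representing Radon measure for a linear functional $\ell\colon S\to\mathbb{R}$ is a Radon measure $\nu$ on $X(S)$ such that, for all $a\in S$, $\hat a$ is $\nu$-integrable and $\ell(a)=\int_{X(S)}\hat a\,d\nu$. It is said to be supported in $C\subseteq X(S)$ if $\nu(X(S)\setminus C)=0$ ($C$ need not be closed). Suppose that there is a Hilbertian seminorm $q$ on $V$ with $\mathrm{tr}(s_L|_V/q)<\infty$ and $\{\alpha\in K:\alpha|_V \text{ is } q\text{-continuous}\}\neq\emptyset$,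 and that for each $S\in J$ there is a representing Radon measure $\nu_S$ for $L|_S$ supported in $K_{Q\cap S}$. Then there is a representing Radon measure for $L$ supported in $\{\alpha\in K:\alpha|_V \text{ is } q\text{-continuous}\}$. -/

import Mathlib

open MeasureTheory
open scoped ENNReal

noncomputable section

namespace MomentProblem

/-! ### Characters -/

/-- The character space `X(A)`: all unital `ℝ`-algebra homomorphisms `A → ℝ`. -/
def CharSpace (A : Type*) [CommRing A] [Algebra ℝ A] : Type _ := A →ₐ[ℝ] ℝ

namespace CharSpace

variable {A : Type*} [CommRing A] [Algebra ℝ A]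

instance : FunLike (CharSpace A) A ℝ := inferInstanceAs (FunLike (A →ₐ[ℝ] ℝ) A ℝ)

instance : AlgHomClass (CharSpace A) ℝ A ℝ :=
  inferInstanceAs (AlgHomClass (A →ₐ[ℝ] ℝ) ℝ A ℝ)

/-- The weakest topology on `X(A)` making every evaluation `α ↦ α a` continuous. -/
instance : TopologicalSpace (CharSpace A) :=
  TopologicalSpace.induced (fun α a => α a : CharSpace A → A → ℝ) inferInstance

/-- `X(A)` carries the Borel `σ`-algebra of its topology. -/
instance : MeasurableSpace (CharSpace A) := borel _

instance : BorelSpace (CharSpace A) := ⟨rfl⟩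

/-- The restriction `α|_V` of a character to a linear subspace `V` of `A`. -/
def restrict (V : Submodule ℝ A) (α : CharSpace A) : V →ₗ[ℝ] ℝ :=
  (AlgHom.toLinearMap (α : A →ₐ[ℝ] ℝ)).domRestrict V

end CharSpace

/-! ### Hilbertian seminorms and their traces -/

section Seminorms

variable {V : Type*} [AddCommGroup V] [Module ℝ V]

/-- `p` is induced by a symmetric positive semidefinite bilinear form. -/
def IsHilbertian (p : Seminorm ℝ V) : Prop :=
  ∃ B : LinearMap.BilinForm ℝ V,
    (∀ v w, B v w = B w v) ∧ (∀ v, 0 ≤ B v v) ∧ ∀ v, p v = √(B v v)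

/-- The bilinear form `⟨v, w⟩_p` of a Hilbertian seminorm `p`, given by polarization. -/
def polarInner (p : Seminorm ℝ V) (v w : V) : ℝ :=
  1 / 2 * (p (v + w) ^ 2 - p v ^ 2 - p w ^ 2)

/-- `E` is a (finite) `p`-orthonormal set. -/
def IsOrthonormalSet (p : Seminorm ℝ V) (E : Finset V) : Prop :=
  (∀ e₁ ∈ E, ∀ e₂ ∈ E, e₁ ≠ e₂ → polarInner p e₁ e₂ = 0) ∧ ∀ e ∈ E, p e = 1

open Classical in
/-- The trace `tr(p/q) ∈ [0, ∞]` of `p` with respect to `q` (for Hilbertian `p`, `q`): the supremum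
of `∑_{e ∈ E} p(e)²` over all finite `q`-orthonormal `E` if `ker q ⊆ ker p`, and `∞` otherwise. -/
def seminormTrace (p q : Seminorm ℝ V) : ℝ≥0∞ :=
  if ∀ v, q v = 0 → p v = 0 then
    ⨆ (E : Finset V) (_ : IsOrthonormalSet q E), ∑ e ∈ E, ENNReal.ofReal (p e ^ 2)
  else ⊤

/-- Continuity of a linear functional with respect to a seminorm. -/
def IsContinuousWrt (q : Seminorm ℝ V) (l : V →ₗ[ℝ] ℝ) : Prop :=
  ∃ C : ℝ, 0 < C ∧ ∀ v, |l v| ≤ C * q v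

end Seminorms

/-! ### Quadratic modules and positive functionals -/

section Algebra

variable {A : Type*} [CommRing A] [Algebra ℝ A]

/-- A quadratic module: `1 ∈ Q`, `Q + Q ⊆ Q` and `A² Q ⊆ Q`. -/
structure IsQuadraticModule (Q : Set A) : Prop where
  one_mem : (1 : A) ∈ Q
  add_mem : ∀ a ∈ Q, ∀ b ∈ Q, a + b ∈ Q
  sq_mul_mem : ∀ a : A, ∀ b ∈ Q, a ^ 2 * b ∈ Q

/-- The non-negativity set `K_Q = {α ∈ X(A) : α(a) ≥ 0 for all a ∈ Q}`. -/
def nonnegSet (Q : Set A) : Set (CharSpace A) := {α | ∀ a ∈ Q, 0 ≤ α a}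

/-- `L` is `∑A²`-positive: non-negative on all finite sums of squares. -/
def IsSumSqPositive (L : A →ₗ[ℝ] ℝ) : Prop := ∀ a : A, IsSumSq a → 0 ≤ L a

theorem IsSumSqPositive.sq_nonneg {L : A →ₗ[ℝ] ℝ} (hL : IsSumSqPositive L) (a : A) :
    0 ≤ L (a ^ 2) :=
  hL _ (by rw [pow_two]; exact IsSumSq.mul_self a)

theorem IsSumSqPositive.cauchySchwarz {L : A →ₗ[ℝ] ℝ} (hL : IsSumSqPositive L) (a b : A) :
    L (a * b) ^ 2 ≤ L (a ^ 2) * L (b ^ 2) := by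
  have key : ∀ t : ℝ, 0 ≤ L (b ^ 2) * (t * t) + 2 * L (a * b) * t + L (a ^ 2) := by
    intro t
    have h := hL.sq_nonneg (a + t • b)
    have e : (a + t • b) ^ 2 = a ^ 2 + (2 * t) • (a * b) + (t * t) • b ^ 2 := by
      simp only [Algebra.smul_def, map_mul, map_ofNat]; ring
    rw [e] at h
    simp only [map_add, map_smul, smul_eq_mul] at h
    linarith
  have := discrim_le_zero key
  unfold discrim at this
  nlinarith

/-- The seminorm `s_L(a) = √(L(a²))` on `A` of a `∑A²`-positive functional `L`. -/
def sL (L : A →ₗ[ℝ] ℝ) (hL : IsSumSqPositive L) : Seminorm ℝ A :=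
  Seminorm.of (fun a => √(L (a ^ 2)))
    (by
      intro a b
      refine Real.sqrt_le_iff.2 ⟨by positivity, ?_⟩
      have hab : L (a * b) ≤ √(L (a ^ 2)) * √(L (b ^ 2)) := by
        rw [← Real.sqrt_mul (hL.sq_nonneg a)]
        exact Real.le_sqrt_of_sq_le (hL.cauchySchwarz a b)
      have e : (a + b) ^ 2 = a ^ 2 + (2 : ℝ) • (a * b) + b ^ 2 := by
        simp only [Algebra.smul_def, map_ofNat]; ring
      rw [e]
      simp only [map_add, map_smul, smul_eq_mul]
      have h1 := Real.sq_sqrt (hL.sq_nonneg a)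
      have h2 := Real.sq_sqrt (hL.sq_nonneg b)
      nlinarith)
    (by
      intro t a
      have e : (t • a) ^ 2 = (t ^ 2) • a ^ 2 := by rw [smul_pow]
      rw [e, map_smul, smul_eq_mul, Real.sqrt_mul (_root_.sq_nonneg t), Real.sqrt_sq_eq_abs,
        Real.norm_eq_abs])

/-- The family `J` of all subalgebras `⟨W⟩` generated by finite dimensional subspaces `W ⊆ V`. -/
def finGenSubalgebras (V : Submodule ℝ A) : Set (Subalgebra ℝ A) :=
  {S | ∃ W : Submodule ℝ A, W ≤ V ∧ FiniteDimensional ℝ W ∧ S = Algebra.adjoin ℝ (W : Set A)}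

/-- The characters in `K` whose restriction to `V` is `q`-continuous. -/
def continuousPart (V : Submodule ℝ A) (q : Seminorm ℝ V) (K : Set (CharSpace A)) :
    Set (CharSpace A) :=
  {α ∈ K | IsContinuousWrt q (α.restrict V)}

/-! ### Representing Radon measures -/

/-- `ν` is a Radon measure on `X(A)` with `L(a) = ∫ α(a) dν(α)` for all `a ∈ A`. -/
structure IsRepresentingRadon (L : A →ₗ[ℝ] ℝ) (ν : Measure (CharSpace A)) : Prop where
  locallyFinite : IsLocallyFiniteMeasure ν
  innerRegular : ν.InnerRegular
  integrable : ∀ a : A, Integrable (fun α : CharSpace A => α a) ν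
  eq_integral : ∀ a : A, L a = ∫ α, α a ∂ν

/-- `ν` is supported in (carried by) `C`: the complement of `C` is a `ν`-null set. The set `C` need
not be closed. -/
def IsSupportedIn (ν : Measure (CharSpace A)) (C : Set (CharSpace A)) : Prop := ν Cᶜ = 0

end Algebra

end MomentProblem

end

open MomentProblem

/-! The proof is a compactness argument; the measures on the subalgebras `cylAlg V F`, `F` a finite
subset of `V`, need not be compatible. Extending characters by zero maps all these character spaces
into the compact space `ExtFun A` of functions `A → EReal`. The image measures have a regular limit
`μ` along an ultrafilter (`exists_regular_limit`), and two things remain to be shown.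

Support: for a `q`-orthonormal basis of the non-null part of span `F`, the integral of `∑ β(e)²` is
`∑ s_L(e)²`, at most the trace `T`. Markov's inequality bounds the mass outside `cylBall V q Q n F`
by `T / n²`, uniformly in `F` (`measure_compl_cylBall_le`). The corresponding closed sets in `ExtFun
A` decrease to a set of genuine characters bounded by `n * q` (`iInter_extending_cylBall_subset`).
Hence `μ` is carried by a countable union of compact sets of `q`-continuous characters in `K`, and
it pulls back to `X(A)` (`exists_innerRegular_map_eq`).

Moments: evaluations are unbounded, but their truncations are continuous on `ExtFun A`, and `L (a ^
2)` controls the truncation error uniformly (`isRepresentingRadon_of_tendsto`). -/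

namespace MomentProblem

open Filter Topology

/-! ### Limits of probability measures on compact spaces -/

section Limits

variable {E : Type*} [TopologicalSpace E] [CompactSpace E] [T2Space E] [MeasurableSpace E]
  [BorelSpace E]

/-- A net of probability measures on a compact Hausdorff space has a regular limit point. -/
theorem exists_regular_limit {ι : Type*} {l : Filter ι} [l.NeBot] (P : ι → ProbabilityMeasure E) :
    ∃ (u : Ultrafilter ι) (μ : Measure E), ↑u ≤ l ∧ μ.Regular ∧ IsFiniteMeasure μ ∧
      ∀ f : C(E, ℝ), Tendsto (fun i => ∫ x, f x ∂(P i : Measure E)) u (𝓝 (∫ x, f x ∂μ)) := by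
  let u := Ultrafilter.of l
  let p := (u.map P).lim
  have hp : Tendsto P u (𝓝 p) := (u.map P).le_nhds_lim
  -- `E` need not be metrizable, so `p` may fail to be regular; a regular measure with the same
  -- integrals of continuous functions replaces it.
  obtain ⟨μ, hμ, hfin, hint⟩ := Measure.exists_regular_eq_of_compactSpace (p : Measure E)
  refine ⟨u, μ, Ultrafilter.of_le l, hμ, hfin, fun f => ?_⟩
  have h := ProbabilityMeasure.tendsto_iff_forall_integral_tendsto.1 hp
    (BoundedContinuousFunction.mkOfCompact f)
  rw [hint] at h
  exact h

/-- Bounds on the mass outside of an antitone family of closed sets pass to the intersection. -/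
theorem measure_compl_iInter_le {ι : Type*} [SemilatticeSup ι] [Nonempty ι] {u : Ultrafilter ι}
    (hu : ↑u ≤ (atTop : Filter ι)) {P : ι → ProbabilityMeasure E} {μ : Measure E} [μ.Regular]
    [IsFiniteMeasure μ]
    (hlim : ∀ f : C(E, ℝ), Tendsto (fun i => ∫ x, f x ∂(P i : Measure E)) u (𝓝 (∫ x, f x ∂μ)))
    {C : ι → Set E} (hC : ∀ i, IsClosed (C i)) (hanti : Antitone C) {ε : ℝ≥0∞}
    (hε : ∀ i, (P i : Measure E) (C i)ᶜ ≤ ε) : μ (⋂ i, C i)ᶜ ≤ ε := by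
  by_cases hεt : ε = ⊤
  · simp [hεt]
  rw [(isClosed_iInter hC).isOpen_compl.measure_eq_iSup_isCompact]
  refine iSup_le fun F => iSup_le fun hF => iSup_le fun hFc => ?_
  rw [Set.compl_iInter] at hF
  -- The complements are a directed open cover of the compact `F`, so one index suffices. This
  -- handles uncountable families, where continuity from above is not available.
  obtain ⟨i₀, hi₀⟩ := hFc.elim_directed_cover (fun i => (C i)ᶜ) (fun i => (hC i).isOpen_compl) hF
    (directed_of_isDirected_le fun i j hij => Set.compl_subset_compl.2 (hanti hij))
  obtain ⟨f, hf0, hf1, hf⟩ := exists_continuous_zero_one_of_isClosed (hC i₀) hFc.isClosed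
    (Set.disjoint_left.2 fun x hx hxF => hi₀ hxF hx)
  have hfi : ∀ ρ : Measure E, IsFiniteMeasure ρ → Integrable f ρ := fun ρ _ =>
    (BoundedContinuousFunction.mkOfCompact f).integrable ρ
  have h1 : μ.real F ≤ ∫ x, f x ∂μ := by
    rw [← integral_indicator_one hFc.measurableSet]
    refine integral_mono ((integrable_const (1 : ℝ)).indicator hFc.measurableSet) (hfi μ ‹_›)
      fun x => ?_
    by_cases hx : x ∈ F
    · simp [hx, hf1 hx]
    · simp [hx, (hf x).1]
  have h2 : ∫ x, f x ∂μ ≤ ε.toReal := by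
    refine le_of_tendsto (hlim f) (hu ((eventually_ge_atTop i₀).mono fun i hi => ?_))
    calc ∫ x, f x ∂(P i : Measure E)
        ≤ ∫ x, (C i₀)ᶜ.indicator 1 x ∂(P i : Measure E) := by
          refine integral_mono (hfi _ inferInstance)
            ((integrable_const (1 : ℝ)).indicator (hC i₀).measurableSet.compl) fun x => ?_
          by_cases hx : x ∈ C i₀
          · simp [hx, hf0 hx]
          · simp [hx, (hf x).2]
      _ = (P i : Measure E).real (C i₀)ᶜ := integral_indicator_one (hC i₀).measurableSet.compl
      _ ≤ ε.toReal := ENNReal.toReal_mono hεt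
          ((measure_mono (Set.compl_subset_compl.2 (hanti hi))).trans (hε i))
  rw [← ENNReal.ofReal_toReal (measure_ne_top μ F), ← ENNReal.ofReal_toReal hεt]
  exact ENNReal.ofReal_le_ofReal (h1.trans h2)

/-- A regular finite measure carried by a `σ`-compact part of an embedded space is the image of an
inner regular measure on that space. -/
theorem exists_innerRegular_map_eq {X : Type*} [TopologicalSpace X] [MeasurableSpace X]
    [BorelSpace X] {e : X → E} (he : IsEmbedding e) {μ : Measure E} [μ.Regular]
    [IsFiniteMeasure μ] {B : ℕ → Set X} (hB : ∀ n, IsCompact (B n))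
    (hμ : μ (e '' ⋃ n, B n)ᶜ = 0) :
    ∃ ν : Measure X, ν.InnerRegular ∧ ν.map e = μ ∧ ν (⋃ n, B n)ᶜ = 0 := by
  have : T2Space X := he.t2Space
  set Y := ⋃ n, B n with hY
  have hYm : MeasurableSet Y := MeasurableSet.iUnion fun n => (hB n).measurableSet
  have hem : MeasurableSet (e '' Y) := by
    rw [hY, Set.image_iUnion]
    exact MeasurableSet.iUnion fun n => ((hB n).image he.continuous).measurableSet
  -- The range of `e` may fail to be Borel, but the image of the `σ`-compact `Y` is Borel, so `μ`
  -- can be pulled back along `g`.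
  let g : Y → E := fun y => e y
  have hg : IsEmbedding g := he.comp IsEmbedding.subtypeVal
  have hrange : Set.range g = e '' Y := by
    ext z; simp [g]
  have hgm : MeasurableEmbedding g := hg.measurableEmbedding (hrange ▸ hem)
  have hreg : (μ.comap g).InnerRegular := ⟨by
    have hμr : μ.InnerRegular := inferInstance
    exact hμr.innerRegular.comap hgm (fun _ hU => hgm.measurableSet_image' hU)
      (fun _ hKr hK => hg.isInducing.isCompact_preimage' hK hKr)⟩
  refine ⟨(μ.comap g).map Subtype.val, Measure.InnerRegular.map_of_continuous (by fun_prop), ?_, ?_⟩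
  · rw [Measure.map_map he.continuous.measurable (by fun_prop)]
    change (μ.comap g).map g = μ
    rw [hgm.map_comap, hrange]
    exact Measure.restrict_eq_self_of_ae_mem hμ
  · rw [Measure.map_apply (by fun_prop) hYm.compl]
    simp

end Limits

/-! ### Truncations -/

/-- The truncation of a real number to `[-M, M]`. -/
def clip (M x : ℝ) : ℝ := max (-M) (min x M)

theorem continuous_clip (M : ℝ) : Continuous (clip M) := by unfold clip; fun_prop

theorem abs_clip_le {M : ℝ} (hM : 0 ≤ M) (x : ℝ) : |clip M x| ≤ |x| := by
  unfold clip; rw [abs_le]; constructor <;> grind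

theorem abs_clip_le_bound {M : ℝ} (hM : 0 ≤ M) (x : ℝ) : |clip M x| ≤ M := by
  unfold clip; rw [abs_le]; constructor <;> grind

theorem clip_eq_self {M x : ℝ} (hx : |x| ≤ M) : clip M x = x := by
  unfold clip; grind

/-- The error vanishes for `|x| ≤ M`, and otherwise is at most `|x| ≤ x² / M`. Second moments thus
control truncated first moments. -/
theorem abs_sub_clip_le {M : ℝ} (hM : 0 < M) (x : ℝ) : |x - clip M x| ≤ x ^ 2 / M := by
  by_cases hx : |x| ≤ M
  · rw [clip_eq_self hx]; simp; positivity
  · push Not at hx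
    rw [le_div_iff₀ hM, ← sq_abs x]
    have h : |x - clip M x| ≤ |x| := by unfold clip; grind
    nlinarith [abs_nonneg x, abs_nonneg (x - clip M x)]

theorem tendsto_clip (x : ℝ) : Tendsto (fun n : ℕ => clip n x) atTop (𝓝 x) := by
  refine tendsto_const_nhds.congr' ?_
  filter_upwards [eventually_ge_atTop ⌈|x|⌉₊] with n hn
  exact (clip_eq_self ((Nat.le_ceil _).trans (by exact_mod_cast hn))).symm

/-- The continuous extension of the truncation to the extended reals. -/
noncomputable def clipE (M : ℝ) (x : EReal) : ℝ := (max (-M : EReal) (min x M)).toReal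

theorem clipE_coe (M x : ℝ) : clipE M x = clip M x := by
  unfold clipE clip
  norm_cast

theorem continuous_clipE (M : ℝ) : Continuous (clipE M) := by
  refine EReal.continuousOn_toReal.comp_continuous (by fun_prop) fun x => ?_
  simp only [Set.mem_compl_iff, Set.mem_insert_iff, Set.mem_singleton_iff, not_or]
  constructor
  · refine ne_of_gt (lt_of_lt_of_le ?_ (le_max_left _ _))
    rw [← EReal.coe_neg]; exact EReal.bot_lt_coe _
  · refine ne_of_lt (max_lt ?_ (lt_of_le_of_lt (min_le_right _ _) (EReal.coe_lt_top _)))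
    rw [← EReal.coe_neg]; exact EReal.coe_lt_top _

/-- The mean of a function whose truncations have controlled first and second moments. -/
theorem integrable_and_integral_eq_of_clip {X : Type*} [MeasurableSpace X] {ν : Measure X}
    [IsFiniteMeasure ν] {f : X → ℝ} (hf : Measurable f) {c m : ℝ}
    -- The shift avoids `c / 0 = 0`, which at level `0` would force `m = 0`.
    (h1 : ∀ n : ℕ, |∫ x, clip (n + 1 : ℕ) (f x) ∂ν - m| ≤ c / (n + 1 : ℕ))
    (h2 : ∀ n : ℕ, ∫ x, clip n (f x) ^ 2 ∂ν ≤ c) :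
    Integrable f ν ∧ ∫ x, f x ∂ν = m := by
  have hclip : ∀ n : ℕ, Measurable fun x => clip n (f x) := fun n =>
    (continuous_clip n).measurable.comp hf
  -- Fatou's lemma bounds the full second moment; since `ν` is finite, integrability of `f` follows.
  have hsq : ∫⁻ x, ENNReal.ofReal (f x ^ 2) ∂ν ≤ ENNReal.ofReal c := by
    have hpt : ∀ x, ENNReal.ofReal (f x ^ 2)
        = liminf (fun n : ℕ => ENNReal.ofReal (clip n (f x) ^ 2)) atTop := fun x =>
      (ENNReal.tendsto_ofReal ((tendsto_clip (f x)).pow 2)).liminf_eq.symm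
    simp_rw [hpt]
    refine (lintegral_liminf_le fun n => ((hclip n).pow_const 2).ennreal_ofReal).trans ?_
    refine liminf_le_of_le (by isBoundedDefault) fun b hb => ?_
    obtain ⟨n, hn⟩ := hb.exists
    refine hn.trans ?_
    rw [← ofReal_integral_eq_lintegral_ofReal _ (Eventually.of_forall fun x => sq_nonneg _)]
    · exact ENNReal.ofReal_le_ofReal (h2 n)
    · refine Integrable.of_bound ((hclip n).pow_const 2).aestronglyMeasurable ((n : ℝ) ^ 2)
        (Eventually.of_forall fun x => ?_)
      rw [Real.norm_eq_abs, abs_pow]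
      exact pow_le_pow_left₀ (abs_nonneg _) (abs_clip_le_bound n.cast_nonneg _) 2
  have hsqi : Integrable (fun x => f x ^ 2) ν :=
    ⟨(hf.pow_const 2).aestronglyMeasurable, by
      rw [hasFiniteIntegral_iff_ofReal (Eventually.of_forall fun x => sq_nonneg _)]
      exact hsq.trans_lt ENNReal.ofReal_lt_top⟩
  have hfi : Integrable f ν :=
    ((memLp_two_iff_integrable_sq hf.aestronglyMeasurable).2 hsqi).integrable (by norm_num)
  refine ⟨hfi, tendsto_nhds_unique (f := fun n : ℕ => ∫ x, clip (n + 1 : ℕ) (f x) ∂ν)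
    (l := atTop) ?_ ?_⟩
  · refine tendsto_integral_of_dominated_convergence (fun x => |f x|)
      (fun n => (hclip _).aestronglyMeasurable) hfi.abs
      (fun n => Eventually.of_forall fun x => ?_)
      (Eventually.of_forall fun x => (tendsto_clip (f x)).comp (tendsto_add_atTop_nat 1))
    exact abs_clip_le (Nat.cast_nonneg _) _
  · rw [tendsto_iff_dist_tendsto_zero]
    refine squeeze_zero (fun _ => dist_nonneg) (fun n => h1 n) ?_
    exact (tendsto_const_div_atTop_nhds_zero_nat c).comp (tendsto_add_atTop_nat 1)

/-! ### Compact sets of characters -/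

section Compactness

variable {A : Type*} [CommRing A] [Algebra ℝ A]

theorem CharSpace.isEmbedding_coe : IsEmbedding (fun (α : CharSpace A) (a : A) => α a) :=
  ⟨⟨rfl⟩, DFunLike.coe_injective⟩

instance : T2Space (CharSpace A) := CharSpace.isEmbedding_coe.t2Space

theorem CharSpace.continuous_eval (a : A) : Continuous fun α : CharSpace A => α a :=
  (continuous_apply a).comp CharSpace.isEmbedding_coe.continuous

/-- Being a unital algebra homomorphism is a family of closed conditions, each involving finitely
many coordinates. -/
theorem CharSpace.isClosedEmbedding_coe :
    IsClosedEmbedding (fun (α : CharSpace A) (a : A) => α a) := by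
  refine ⟨CharSpace.isEmbedding_coe, ?_⟩
  have h : Set.range (fun (α : CharSpace A) (a : A) => α a) =
      {f : A → ℝ | (∀ r, f (algebraMap ℝ A r) = r) ∧ (∀ a b, f (a + b) = f a + f b) ∧
        ∀ a b, f (a * b) = f a * f b} := by
    ext f
    constructor
    · rintro ⟨α, rfl⟩
      exact ⟨fun r => AlgHomClass.commutes α r, fun a b => map_add α a b, fun a b => map_mul α a b⟩
    · rintro ⟨h1, h2, h3⟩
      let α : A →ₐ[ℝ] ℝ :=
        { toFun := f
          map_one' := by simpa using h1 1
          map_mul' := h3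
          map_zero' := by simpa using h1 0
          map_add' := h2
          commutes' := h1 }
      exact ⟨(α : CharSpace A), rfl⟩
  rw [h]
  simp only [Set.ofPred_and, Set.ofPred_forall]
  refine (isClosed_iInter fun r => ?_).inter ((isClosed_iInter fun a => isClosed_iInter fun b => ?_).inter
    (isClosed_iInter fun a => isClosed_iInter fun b => ?_))
  all_goals exact isClosed_eq (by fun_prop) (by fun_prop)

/-- A closed set of characters that is pointwise bounded on a set of generators is compact. -/
theorem isCompact_of_bounded_on_generators {G : Set (CharSpace A)} (hG : IsClosed G) {W : Set A}
    (hW : Algebra.adjoin ℝ W = ⊤) (hb : ∀ w ∈ W, ∃ c, ∀ α ∈ G, |α w| ≤ c) : IsCompact G := by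
  -- Bounds propagate through sums and products, which places `G` in a product of compact intervals.
  have hbound : ∀ a : A, ∃ c, ∀ α ∈ G, |α a| ≤ c := by
    intro a
    have ha : a ∈ Algebra.adjoin ℝ W := hW ▸ Algebra.mem_top
    induction ha using Algebra.adjoin_induction with
    | mem x hx => exact hb x hx
    | algebraMap r => exact ⟨|r|, fun α _ => by rw [AlgHomClass.commutes]; simp⟩
    | add x y _ _ hx hy =>
      obtain ⟨c, hc⟩ := hx
      obtain ⟨d, hd⟩ := hy
      exact ⟨c + d, fun α hα => by
        rw [map_add]; exact (abs_add_le _ _).trans (add_le_add (hc α hα) (hd α hα))⟩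
    | mul x y _ _ hx hy =>
      obtain ⟨c, hc⟩ := hx
      obtain ⟨d, hd⟩ := hy
      exact ⟨c * d, fun α hα => by
        rw [map_mul, abs_mul]
        exact mul_le_mul (hc α hα) (hd α hα) (abs_nonneg _) ((abs_nonneg _).trans (hc α hα))⟩
  choose c hc using hbound
  have hK := CharSpace.isClosedEmbedding_coe.isCompact_preimage
    (isCompact_univ_pi fun a => isCompact_Icc (a := -c a) (b := c a))
  refine hK.of_isClosed_subset hG fun α hα => ?_
  exact fun a _ => abs_le.1 (hc a α hα)

theorem isClosed_nonnegSet (Q : Set A) : IsClosed (nonnegSet Q) := by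
  unfold nonnegSet
  simp only [Set.ofPred_forall]
  exact isClosed_iInter fun a => isClosed_iInter fun _ =>
    isClosed_le continuous_const (CharSpace.continuous_eval a)

/-- The restriction of a character to a smaller subalgebra. -/
def CharSpace.restrictSubalgebra {S T : Subalgebra ℝ A} (h : S ≤ T) (β : CharSpace T) :
    CharSpace S :=
  AlgHom.comp (β : T →ₐ[ℝ] ℝ) (Subalgebra.inclusion h)

theorem CharSpace.restrictSubalgebra_apply {S T : Subalgebra ℝ A} (h : S ≤ T) (β : CharSpace T)
    (s : S) : β.restrictSubalgebra h s = β (Subalgebra.inclusion h s) := rfl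

end Compactness

/-! ### A compactification -/

/-- The space of all functions to the extended reals with its product topology and the Borel
`σ`-algebra. -/
def ExtFun (A : Type*) : Type _ := A → EReal

namespace ExtFun

variable {A : Type*}

noncomputable instance : TopologicalSpace (ExtFun A) := inferInstanceAs (TopologicalSpace (A → EReal))
instance : CompactSpace (ExtFun A) := inferInstanceAs (CompactSpace (A → EReal))
instance : T2Space (ExtFun A) := inferInstanceAs (T2Space (A → EReal))
noncomputable instance : MeasurableSpace (ExtFun A) := borel _
instance : BorelSpace (ExtFun A) := ⟨rfl⟩

theorem continuous_eval (a : A) : Continuous fun z : ExtFun A => z a :=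
  continuous_apply (A := fun _ : A => EReal) a

variable [CommRing A] [Algebra ℝ A]

/-- The inclusion of the character space in its compactification. -/
def ofChar (α : CharSpace A) : ExtFun A := fun a => (α a : EReal)

theorem isEmbedding_ofChar : IsEmbedding (ofChar : CharSpace A → ExtFun A) := by
  have h : IsEmbedding (Pi.map (fun _ : A => ((↑) : ℝ → EReal))) :=
    IsEmbedding.piMap fun _ => EReal.isEmbedding_coe
  exact h.comp CharSpace.isEmbedding_coe

open Classical in
/-- Characters of a subalgebra as functions on the whole algebra, extended by zero. -/
noncomputable def ofSubalgebra (S : Subalgebra ℝ A) (β : CharSpace S) : ExtFun A :=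
  -- The value off `S` is immaterial: each `a` eventually lies in the subalgebras of the net.
  fun a => if h : a ∈ S then (β ⟨a, h⟩ : EReal) else 0

theorem ofSubalgebra_apply {S : Subalgebra ℝ A} (β : CharSpace S) {a : A} (h : a ∈ S) :
    ofSubalgebra S β a = (β ⟨a, h⟩ : EReal) := dif_pos h

theorem continuous_ofSubalgebra (S : Subalgebra ℝ A) : Continuous (ofSubalgebra S) := by
  refine continuous_pi fun a => ?_
  by_cases h : a ∈ S
  · simp only [ofSubalgebra, h, dif_pos]
    exact continuous_coe_real_ereal.comp (CharSpace.continuous_eval _)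
  · simp only [ofSubalgebra, h, dif_neg, not_false_eq_true]
    exact continuous_const

/-- The extended functions that restrict on `S` to a character in `G`. -/
def extending {S : Subalgebra ℝ A} (G : Set (CharSpace S)) : Set (ExtFun A) :=
  {z | ∃ β ∈ G, ∀ s : S, z s = (β s : EReal)}

/-- Compactness of `G` prevents escape to infinite values: its image in `S → EReal` is compact,
hence closed, and restriction to `S` is continuous. -/
theorem isClosed_extending {S : Subalgebra ℝ A} {G : Set (CharSpace S)} (hG : IsCompact G) :
    IsClosed (extending G) := by
  have h1 : IsCompact ((fun (β : CharSpace S) (s : S) => (β s : EReal)) '' G) :=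
    hG.image (continuous_pi fun s => continuous_coe_real_ereal.comp (CharSpace.continuous_eval s))
  have h2 : Continuous fun (z : ExtFun A) (s : S) => z s :=
    continuous_pi fun s => continuous_eval (s : A)
  convert h1.isClosed.preimage h2 using 1
  ext z
  simp only [extending, Set.mem_ofPred_eq, Set.mem_preimage, Set.mem_image, funext_iff]
  exact exists_congr fun β => and_congr_right fun _ => forall_congr' fun s => eq_comm

theorem ofSubalgebra_mem_extending {S : Subalgebra ℝ A} {G : Set (CharSpace S)} {β : CharSpace S}
    (hβ : β ∈ G) : ofSubalgebra S β ∈ extending G :=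
  ⟨β, hβ, fun s => ofSubalgebra_apply β s.2⟩

end ExtFun

/-! ### Orthonormal sets in finite dimensional spaces -/

section Orthonormal

variable {V : Type*} [AddCommGroup V] [Module ℝ V]

theorem polarInner_eq {q : Seminorm ℝ V} {B : LinearMap.BilinForm ℝ V}
    (hsymm : ∀ v w, B v w = B w v) (hpos : ∀ v, 0 ≤ B v v) (hq : ∀ v, q v = √(B v v)) (v w : V) :
    polarInner q v w = B v w := by
  simp only [polarInner, hq, Real.sq_sqrt (hpos _)]
  simp only [map_add, LinearMap.add_apply, hsymm w v]
  ring

open Classical in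
/-- On a finite dimensional subspace the dual norm of a Hilbertian seminorm is computed by an
orthonormal set and finitely many null vectors. -/
theorem IsHilbertian.exists_orthonormalSet {q : Seminorm ℝ V} (hq : IsHilbertian q)
    (U : Submodule ℝ V) [FiniteDimensional ℝ U] :
    ∃ E N : Finset U, IsOrthonormalSet q (E.map (Function.Embedding.subtype _)) ∧ (∀ u ∈ N, q u = 0) ∧
      ∀ l : U →ₗ[ℝ] ℝ, (∀ u ∈ N, l u = 0) →
        ∀ w : U, l w ^ 2 ≤ (∑ e ∈ E, l e ^ 2) * q w ^ 2 := by
  obtain ⟨B, hsymm, hpos, hqB⟩ := hq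
  -- Diagonalize the form: normalized vectors of positive length give `E`, the others `N`. A
  -- functional vanishing on `N` is then estimated by Cauchy–Schwarz in the coordinates `c i * √(d
  -- i)`.
  obtain ⟨b, hb⟩ := LinearMap.BilinForm.exists_orthogonal_basis (B := B.restrict U)
    ⟨fun x y => hsymm x y⟩
  have hb' : ∀ i j, i ≠ j → B (b i) (b j) = 0 := fun i j hij => hb hij
  let d := fun i => B (b i) (b i)
  let P := Finset.univ.filter fun i => 0 < d i
  let Z := Finset.univ.filter fun i => ¬ 0 < d i
  have hd0 : ∀ i ∈ Z, d i = 0 := fun i hi =>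
    le_antisymm (not_lt.1 (Finset.mem_filter.1 hi).2) (hpos _)
  have hdpos : ∀ i ∈ P, 0 < d i := fun i hi => (Finset.mem_filter.1 hi).2
  let e := fun i => (√(d i))⁻¹ • b i
  have hee : ∀ i j, B (e i) (e j) = (√(d i))⁻¹ * ((√(d j))⁻¹ * B (b i) (b j)) := by
    intro i j; simp [e]; ring
  have he1 : ∀ i ∈ P, B (e i) (e i) = 1 := by
    intro i hi
    have h := Real.sqrt_pos.2 (hdpos i hi)
    rw [hee, ← mul_assoc, ← mul_inv, Real.mul_self_sqrt (hdpos i hi).le]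
    exact inv_mul_cancel₀ (hdpos i hi).ne'
  have he0 : ∀ i j, i ≠ j → B (e i) (e j) = 0 := fun i j hij => by rw [hee, hb' i j hij]; simp
  have hinj : Set.InjOn e P := by
    intro i hi j hj hij
    by_contra hne
    have h := he0 i j hne
    rw [← hij, he1 i hi] at h
    exact one_ne_zero h
  refine ⟨P.image e, Z.image b, ⟨?_, ?_⟩, ?_, ?_⟩
  · simp only [Finset.mem_map, Finset.mem_image]
    rintro _ ⟨_, ⟨i, hi, rfl⟩, rfl⟩ _ ⟨_, ⟨j, hj, rfl⟩, rfl⟩ hij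
    rw [polarInner_eq hsymm hpos hqB]
    exact he0 i j fun h => hij (by rw [h])
  · simp only [Finset.mem_map, Finset.mem_image]
    rintro _ ⟨_, ⟨i, hi, rfl⟩, rfl⟩
    rw [hqB]
    exact (congrArg _ (he1 i hi)).trans Real.sqrt_one
  · simp only [Finset.mem_image]
    rintro _ ⟨i, hi, rfl⟩
    rw [hqB]
    exact (congrArg _ (hd0 i hi)).trans Real.sqrt_zero
  · intro l hl w
    have hlZ : ∀ i ∈ Z, l (b i) = 0 := fun i hi => hl _ (Finset.mem_image_of_mem _ hi)
    let c := b.repr w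
    have hw : ∑ i, c i • b i = w := b.sum_repr w
    have hqw : q w ^ 2 = ∑ i ∈ P, c i ^ 2 * d i := by
      rw [hqB, Real.sq_sqrt (hpos _)]
      have h1 : B (w : V) (w : V) = ∑ i, c i ^ 2 * d i := by
        have hwV : (w : V) = ∑ i, c i • (b i : V) := by
          simpa using (congrArg Subtype.val hw).symm
        rw [hwV]
        simp only [map_sum, map_smul, LinearMap.sum_apply, LinearMap.smul_apply, smul_eq_mul]
        refine Finset.sum_congr rfl fun i _ => ?_
        rw [Finset.sum_eq_single i (fun j _ hj => by rw [hb' j i hj]; simp) (by simp)]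
        ring
      rw [h1]
      refine (Finset.sum_subset (Finset.subset_univ P) fun i _ hi => ?_).symm
      rw [hd0 i (by simpa [P, Z] using hi), mul_zero]
    have hlw : l w = ∑ i ∈ P, l (e i) * (c i * √(d i)) := by
      have h1 : l w = ∑ i, c i * l (b i) := by
        simpa using (congrArg l hw).symm
      rw [h1]
      rw [← Finset.sum_subset (Finset.subset_univ P) fun i _ hi => by
        rw [hlZ i (by simpa [P, Z] using hi), mul_zero]]
      refine Finset.sum_congr rfl fun i hi => ?_
      have h := (Real.sqrt_pos.2 (hdpos i hi)).ne'
      simp only [e, map_smul, smul_eq_mul]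
      field_simp
    rw [hlw, hqw, Finset.sum_image hinj]
    refine (Finset.sum_mul_sq_le_sq_mul_sq P _ _).trans_eq ?_
    congr 1
    exact Finset.sum_congr rfl fun i hi => by rw [mul_pow, Real.sq_sqrt (hdpos i hi).le]

theorem eq_zero_of_seminormTrace_lt_top {p q : Seminorm ℝ V} (h : seminormTrace p q < ⊤) {v : V}
    (hv : q v = 0) : p v = 0 := by
  by_contra hp
  rw [seminormTrace, if_neg fun h' => hp (h' v hv)] at h
  exact lt_irrefl _ h

theorem sum_le_seminormTrace (p : Seminorm ℝ V) {q : Seminorm ℝ V} {E : Finset V}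
    (hE : IsOrthonormalSet q E) : ∑ e ∈ E, ENNReal.ofReal (p e ^ 2) ≤ seminormTrace p q := by
  unfold seminormTrace
  split_ifs
  · exact le_iSup₂ (f := fun (E : Finset V) (_ : IsOrthonormalSet q E) =>
      ∑ e ∈ E, ENNReal.ofReal (p e ^ 2)) E hE
  · exact le_top

end Orthonormal

/-! ### The finitely generated subalgebras -/

section Cylinder

variable {A : Type*} [CommRing A] [Algebra ℝ A]

/-- The subalgebra of `A` generated by the span of a finite subset of `V`. -/
def cylAlg (V : Submodule ℝ A) (F : Finset V) : Subalgebra ℝ A :=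
  Algebra.adjoin ℝ (((Submodule.span ℝ (F : Set V)).map V.subtype : Submodule ℝ A) : Set A)

theorem cylAlg_mem (V : Submodule ℝ A) (F : Finset V) : cylAlg V F ∈ finGenSubalgebras V :=
  ⟨_, Submodule.map_subtype_le _ _, inferInstance, rfl⟩

theorem cylAlg_mono (V : Submodule ℝ A) : Monotone (cylAlg V) := fun _ _ h =>
  Algebra.adjoin_mono (Submodule.map_mono (Submodule.span_mono (Finset.coe_subset.2 h)))

theorem coe_mem_cylAlg {V : Submodule ℝ A} {F : Finset V} {v : V}
    (hv : v ∈ Submodule.span ℝ (F : Set V)) : (v : A) ∈ cylAlg V F :=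
  Algebra.subset_adjoin (Submodule.mem_map_of_mem (f := V.subtype) hv)

theorem coe_mem_cylAlg_of_mem {V : Submodule ℝ A} {F : Finset V} {v : V} (hv : v ∈ F) :
    (v : A) ∈ cylAlg V F := coe_mem_cylAlg (Submodule.subset_span hv)

theorem exists_mem_cylAlg {V : Submodule ℝ A} (hV : Algebra.adjoin ℝ (V : Set A) = ⊤) (a : A) :
    ∃ F, a ∈ cylAlg V F := by
  classical
  have ha : a ∈ Algebra.adjoin ℝ (V : Set A) := hV ▸ Algebra.mem_top
  induction ha using Algebra.adjoin_induction with
  | mem x hx =>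
    exact ⟨{⟨x, hx⟩}, coe_mem_cylAlg_of_mem (v := ⟨x, hx⟩) (Finset.mem_singleton_self _)⟩
  | algebraMap r => exact ⟨∅, Subalgebra.algebraMap_mem _ r⟩
  | add x y _ _ hx hy =>
    obtain ⟨F, hF⟩ := hx
    obtain ⟨G, hG⟩ := hy
    exact ⟨F ∪ G, add_mem (cylAlg_mono V Finset.subset_union_left hF)
      (cylAlg_mono V Finset.subset_union_right hG)⟩
  | mul x y _ _ hx hy =>
    obtain ⟨F, hF⟩ := hx
    obtain ⟨G, hG⟩ := hy
    exact ⟨F ∪ G, mul_mem (cylAlg_mono V Finset.subset_union_left hF)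
      (cylAlg_mono V Finset.subset_union_right hG)⟩

theorem eventually_mem_cylAlg {V : Submodule ℝ A} (hV : Algebra.adjoin ℝ (V : Set A) = ⊤) (a : A) :
    ∀ᶠ F in atTop, a ∈ cylAlg V F := by
  obtain ⟨F, hF⟩ := exists_mem_cylAlg hV a
  exact (eventually_ge_atTop F).mono fun G hG => cylAlg_mono V hG hF

/-- The inclusion of the span of `F` in the subalgebra it generates. -/
def spanToCylAlg (V : Submodule ℝ A) (F : Finset V) :
    Submodule.span ℝ (F : Set V) →ₗ[ℝ] cylAlg V F where
  toFun u := ⟨(u : V), coe_mem_cylAlg u.2⟩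
  map_add' _ _ := rfl
  map_smul' _ _ := rfl

theorem coe_spanToCylAlg {V : Submodule ℝ A} {F : Finset V} (u : Submodule.span ℝ (F : Set V)) :
    (spanToCylAlg V F u : A) = (u : V) := rfl

/-- The characters that are non-negative on `Q` and bounded by `n` times `q` on `V`. -/
def charBall (V : Submodule ℝ A) (q : Seminorm ℝ V) (Q : Set A) (n : ℕ) : Set (CharSpace A) :=
  {α | ∀ v : V, |α v| ≤ n * q v} ∩ nonnegSet Q

/-- The characters of `cylAlg V F` that are non-negative on `Q` and bounded by `n` times `q`. -/
def cylBall (V : Submodule ℝ A) (q : Seminorm ℝ V) (Q : Set A) (n : ℕ) (F : Finset V) :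
    Set (CharSpace (cylAlg V F)) :=
  {β | ∀ u : Submodule.span ℝ (F : Set V), |β (spanToCylAlg V F u)| ≤ n * q u} ∩
    nonnegSet {s : cylAlg V F | (s : A) ∈ Q}

variable {V : Submodule ℝ A} {q : Seminorm ℝ V} {Q : Set A}

theorem isCompact_charBall (hV : Algebra.adjoin ℝ (V : Set A) = ⊤) (n : ℕ) :
    IsCompact (charBall V q Q n) := by
  refine isCompact_of_bounded_on_generators (IsClosed.inter ?_ (isClosed_nonnegSet Q)) hV
    fun w hw => ⟨n * q ⟨w, hw⟩, fun α hα => hα.1 ⟨w, hw⟩⟩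
  simp only [Set.ofPred_forall]
  exact isClosed_iInter fun v =>
    isClosed_le (CharSpace.continuous_eval _).abs continuous_const

theorem isCompact_cylBall (n : ℕ) (F : Finset V) : IsCompact (cylBall V q Q n F) := by
  refine isCompact_of_bounded_on_generators (IsClosed.inter ?_ (isClosed_nonnegSet _))
    Algebra.adjoin_adjoin_coe_preimage ?_
  · simp only [Set.ofPred_forall]
    exact isClosed_iInter fun v =>
      isClosed_le (CharSpace.continuous_eval _).abs continuous_const
  · rintro ⟨w, hw⟩ hw'
    obtain ⟨u, hu, rfl⟩ := hw'
    exact ⟨n * q u, fun β hβ => hβ.1 ⟨u, hu⟩⟩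

theorem charBall_subset_continuousPart (n : ℕ) :
    charBall V q Q n ⊆ continuousPart V q (nonnegSet Q) := fun _ hα =>
  ⟨hα.2, (n : ℝ) + 1, Nat.cast_add_one_pos n, fun v => (hα.1 v).trans
    (mul_le_mul_of_nonneg_right (le_add_of_nonneg_right zero_le_one) (apply_nonneg q v))⟩

theorem mem_cylBall {n : ℕ} {F : Finset V} {β : CharSpace (cylAlg V F)} :
    β ∈ cylBall V q Q n F ↔
      (∀ u : Submodule.span ℝ (F : Set V), |β (spanToCylAlg V F u)| ≤ n * q u) ∧
        ∀ s : cylAlg V F, (s : A) ∈ Q → 0 ≤ β s := Iff.rfl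

theorem restrictSubalgebra_mem_cylBall {n : ℕ} {F G : Finset V} (hFG : F ≤ G)
    {β : CharSpace (cylAlg V G)} (hβ : β ∈ cylBall V q Q n G) :
    β.restrictSubalgebra (cylAlg_mono V hFG) ∈ cylBall V q Q n F := by
  rw [mem_cylBall] at hβ ⊢
  refine ⟨fun u => ?_, fun s hs => ?_⟩
  · have hu := Submodule.span_mono (R := ℝ) (Finset.coe_subset.2 hFG) u.2
    have h : Subalgebra.inclusion (cylAlg_mono V hFG) (spanToCylAlg V F u) =
        spanToCylAlg V G ⟨u, hu⟩ := by
      apply Subtype.ext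
      rw [Subalgebra.coe_inclusion, coe_spanToCylAlg, coe_spanToCylAlg]
    rw [CharSpace.restrictSubalgebra_apply, h]
    exact hβ.1 ⟨u, hu⟩
  · rw [CharSpace.restrictSubalgebra_apply]
    exact hβ.2 _ (by rwa [Subalgebra.coe_inclusion])

/-- Restricting a character to a smaller subalgebra keeps both the bound and the positivity. -/
theorem antitone_extending_cylBall (n : ℕ) :
    Antitone fun F => ExtFun.extending (cylBall V q Q n F) := by
  rintro F G hFG z ⟨β, hβ, hz⟩
  refine ⟨β.restrictSubalgebra (cylAlg_mono V hFG), restrictSubalgebra_mem_cylBall hFG hβ,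
    fun s => ?_⟩
  rw [CharSpace.restrictSubalgebra_apply, ← hz, Subalgebra.coe_inclusion]

/-- Compatible families of bounded characters on the finitely generated subalgebras come from bounded
characters. -/
theorem iInter_extending_cylBall_subset (hV : Algebra.adjoin ℝ (V : Set A) = ⊤) (n : ℕ) :
    ⋂ F, ExtFun.extending (cylBall V q Q n F) ⊆ ExtFun.ofChar '' charBall V q Q n := by
  classical
  intro z hz
  rw [Set.mem_iInter] at hz
  choose β hβ hzβ using hz
  have hval : ∀ F {a : A} (ha : a ∈ cylAlg V F), (z a).toReal = β F ⟨a, ha⟩ := fun F a ha => by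
    rw [hzβ F ⟨a, ha⟩, EReal.toReal_coe]
  have hpair : ∀ a b : A, ∃ F, a ∈ cylAlg V F ∧ b ∈ cylAlg V F := fun a b =>
    ((eventually_mem_cylAlg hV a).and (eventually_mem_cylAlg hV b)).exists
  -- Each identity involves at most two elements and their sum or product, all in one `cylAlg V F`,
  -- so it is inherited from `β F`.
  let α : A →ₐ[ℝ] ℝ :=
    { toFun := fun a => (z a).toReal
      map_one' := by rw [hval ∅ (one_mem _)]; exact map_one (β ∅)
      map_zero' := by rw [hval ∅ (zero_mem _)]; exact map_zero (β ∅)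
      map_mul' := fun a b => by
        obtain ⟨F, ha, hb⟩ := hpair a b
        rw [hval F ha, hval F hb, hval F (mul_mem ha hb)]
        exact map_mul (β F) ⟨a, ha⟩ ⟨b, hb⟩
      map_add' := fun a b => by
        obtain ⟨F, ha, hb⟩ := hpair a b
        rw [hval F ha, hval F hb, hval F (add_mem ha hb)]
        exact map_add (β F) ⟨a, ha⟩ ⟨b, hb⟩
      commutes' := fun r => by
        rw [hval ∅ (Subalgebra.algebraMap_mem _ r)]
        exact AlgHomClass.commutes (β ∅) r }
  obtain ⟨α', hα⟩ : ∃ α' : CharSpace A, ∀ a, α' a = (z a).toReal := ⟨α, fun a => rfl⟩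
  refine ⟨α', ⟨fun v => ?_, fun a ha => ?_⟩, funext fun a => ?_⟩
  · have hv : v ∈ Submodule.span ℝ ((({v} : Finset V) : Set V)) :=
      Submodule.subset_span (by simp)
    rw [hα, hval {v} (coe_mem_cylAlg hv)]
    exact (hβ {v}).1 ⟨v, hv⟩
  · obtain ⟨F, hF⟩ := exists_mem_cylAlg hV a
    rw [hα, hval F hF]
    exact (hβ F).2 ⟨a, hF⟩ ha
  · obtain ⟨F, hF⟩ := exists_mem_cylAlg hV a
    change (α' a : EReal) = z a
    rw [hα, hval F hF, hzβ F ⟨a, hF⟩]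

end Cylinder

/-! ### Mass and moment estimates for representing measures -/

section Estimates

variable {A : Type*} [CommRing A] [Algebra ℝ A]

theorem IsRepresentingRadon.isProbabilityMeasure {L : A →ₗ[ℝ] ℝ} {ν : Measure (CharSpace A)}
    (hν : IsRepresentingRadon L ν) (hL1 : L 1 = 1) : IsProbabilityMeasure ν := by
  have h1 : Integrable (fun _ : CharSpace A => (1 : ℝ)) ν := by
    simpa only [map_one] using hν.integrable 1
  have : IsFiniteMeasure ν := by simpa [integrable_const_iff] using h1
  have h2 := hν.eq_integral 1
  simp only [hL1, map_one, integral_const, smul_eq_mul, mul_one] at h2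
  refine ⟨?_⟩
  rw [← ENNReal.ofReal_toReal (measure_ne_top ν Set.univ)]
  exact (congrArg ENNReal.ofReal h2.symm).trans ENNReal.ofReal_one

theorem IsRepresentingRadon.lintegral_sq {L : A →ₗ[ℝ] ℝ} {ν : Measure (CharSpace A)}
    (hν : IsRepresentingRadon L ν) (a : A) :
    ∫⁻ α : CharSpace A, ENNReal.ofReal (α a ^ 2) ∂ν = ENNReal.ofReal (L (a ^ 2)) := by
  have h := hν.integrable (a ^ 2)
  rw [hν.eq_integral]
  simp only [map_pow] at h ⊢
  exact (ofReal_integral_eq_lintegral_ofReal h (Eventually.of_forall fun _ => sq_nonneg _)).symm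

/-- The truncated first moments of a representing measure. -/
theorem IsRepresentingRadon.abs_integral_clip_sub_le {L : A →ₗ[ℝ] ℝ} {ν : Measure (CharSpace A)}
    (hν : IsRepresentingRadon L ν) (a : A) {M : ℝ} (hM : 0 < M) :
    |∫ α : CharSpace A, clip M (α a) ∂ν - L a| ≤ L (a ^ 2) / M := by
  have ha := hν.integrable a
  have ha2 := hν.integrable (a ^ 2)
  simp only [map_pow] at ha2
  have hc : Integrable (fun α : CharSpace A => clip M (α a)) ν :=
    ha.mono ((continuous_clip M).comp (CharSpace.continuous_eval a)).aestronglyMeasurable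
      (Eventually.of_forall fun α => abs_clip_le hM.le _)
  rw [hν.eq_integral a, hν.eq_integral (a ^ 2), abs_sub_comm, ← integral_sub ha hc,
    ← integral_div]
  refine abs_integral_le_integral_abs.trans ?_
  simp only [map_pow]
  exact integral_mono (ha.sub hc).abs (ha2.div_const M) fun α => abs_sub_clip_le hM _

/-- The truncated second moments of a representing measure. -/
theorem IsRepresentingRadon.integral_clip_sq_le {L : A →ₗ[ℝ] ℝ} {ν : Measure (CharSpace A)}
    (hν : IsRepresentingRadon L ν) (a : A) {M : ℝ} (hM : 0 ≤ M) :
    ∫ α : CharSpace A, clip M (α a) ^ 2 ∂ν ≤ L (a ^ 2) := by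
  have ha2 := hν.integrable (a ^ 2)
  rw [hν.eq_integral (a ^ 2)]
  simp only [map_pow] at ha2 ⊢
  have hle : ∀ α : CharSpace A, clip M (α a) ^ 2 ≤ α a ^ 2 := fun α =>
    sq_le_sq.2 (abs_clip_le hM _)
  refine integral_mono (ha2.mono
    (((continuous_clip M).comp (CharSpace.continuous_eval a)).pow 2).aestronglyMeasurable
    (Eventually.of_forall fun α => ?_)) ha2 hle
  simp only [Real.norm_eq_abs, abs_pow, sq_abs]
  exact hle α

/-- The trace condition bounds the mass outside of the balls uniformly. -/
theorem measure_compl_cylBall_le {V : Submodule ℝ A} {q : Seminorm ℝ V} {Q : Set A}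
    (hq : IsHilbertian q) {L : A →ₗ[ℝ] ℝ} (hL : IsSumSqPositive L)
    (htr : seminormTrace ((sL L hL).comp V.subtype) q < ⊤) {F : Finset V}
    {ν : Measure (CharSpace (cylAlg V F))}
    (hν : IsRepresentingRadon (L ∘ₗ (cylAlg V F).val.toLinearMap) ν)
    (hνQ : IsSupportedIn ν (nonnegSet {s : cylAlg V F | (s : A) ∈ Q})) {n : ℕ} (hn : n ≠ 0) :
    ν (cylBall V q Q n F)ᶜ ≤ seminormTrace ((sL L hL).comp V.subtype) q / (n : ℝ≥0∞) ^ 2 := by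
  classical
  set p := (sL L hL).comp V.subtype with hp
  obtain ⟨E, N, hE, hN, hbound⟩ := hq.exists_orthonormalSet (Submodule.span ℝ (F : Set V))
  let j := spanToCylAlg V F
  have hpsq : ∀ u : Submodule.span ℝ (F : Set V),
      (L ∘ₗ (cylAlg V F).val.toLinearMap) (j u ^ 2) = p u ^ 2 := fun u =>
    (Real.sq_sqrt (hL.sq_nonneg ((u : V) : A))).symm
  have hsq : ∀ u : Submodule.span ℝ (F : Set V),
      ∫⁻ β : CharSpace (cylAlg V F), ENNReal.ofReal (β (j u) ^ 2) ∂ν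
        = ENNReal.ofReal (p u ^ 2) := fun u => by
    rw [hν.lintegral_sq, hpsq]
  have hmeas : ∀ u, Measurable fun β : CharSpace (cylAlg V F) => ENNReal.ofReal (β (j u) ^ 2) :=
    fun u => ((CharSpace.continuous_eval (j u)).pow 2).measurable.ennreal_ofReal
  -- Finite trace forces `p u = 0` on `q`-null vectors, so the second moment of `β (j u)` vanishes.
  have hnull : ∀ u ∈ N, ν {β | β (j u) ≠ 0} = 0 := by
    intro u hu
    have h0 := hsq u
    rw [eq_zero_of_seminormTrace_lt_top htr (hN u hu)] at h0
    simp only [ne_eq, OfNat.ofNat_ne_zero, not_false_eq_true, zero_pow, ENNReal.ofReal_zero] at h0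
    rw [lintegral_eq_zero_iff (hmeas u)] at h0
    refine measure_mono_null (fun β hβ => ?_) h0
    simp only [Set.mem_compl_iff, Set.mem_ofPred_eq, Pi.zero_apply, ENNReal.ofReal_eq_zero, not_le]
    exact pow_pos (abs_pos.2 hβ) 2 |>.trans_eq (sq_abs _)
  -- A non-negative character that kills `N` and has `∑ β(e)² < n²` lies in the ball by `hbound`;
  -- the last set is left to Markov's inequality.
  have hcover : (cylBall V q Q n F)ᶜ ⊆ ((nonnegSet {s : cylAlg V F | (s : A) ∈ Q})ᶜ ∪
      ⋃ u ∈ N, {β | β (j u) ≠ 0}) ∪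
        {β | (n : ℝ≥0∞) ^ 2 ≤ ∑ e ∈ E, ENNReal.ofReal (β (j e) ^ 2)} := by
    intro β hβ
    by_contra hcon
    simp only [Set.mem_union, Set.mem_compl_iff, Set.mem_iUnion, Set.mem_ofPred_eq, not_or, not_not,
      not_exists, not_le] at hcon
    obtain ⟨⟨h1, h2⟩, h3⟩ := hcon
    refine hβ ⟨fun u => ?_, h1⟩
    have h4 : ∑ e ∈ E, β (j e) ^ 2 ≤ (n : ℝ) ^ 2 := by
      rw [← ENNReal.ofReal_sum_of_nonneg fun _ _ => sq_nonneg _] at h3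
      have h5 : (n : ℝ≥0∞) ^ 2 = ENNReal.ofReal ((n : ℝ) ^ 2) := by
        rw [ENNReal.ofReal_pow n.cast_nonneg, ENNReal.ofReal_natCast]
      rw [h5] at h3
      exact ((ENNReal.ofReal_lt_ofReal_iff_of_nonneg
        (Finset.sum_nonneg fun _ _ => sq_nonneg _)).1 h3).le
    have h6 := hbound ((AlgHom.toLinearMap (β : cylAlg V F →ₐ[ℝ] ℝ)).comp j) h2 u
    refine abs_le_of_sq_le_sq ?_ (mul_nonneg n.cast_nonneg (apply_nonneg q _))
    rw [mul_pow]
    exact h6.trans (mul_le_mul_of_nonneg_right h4 (sq_nonneg _))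
  refine (measure_mono hcover).trans ((measure_union_le _ _).trans ?_)
  have h0 : ν ((nonnegSet {s : cylAlg V F | (s : A) ∈ Q})ᶜ ∪ ⋃ u ∈ N, {β | β (j u) ≠ 0}) = 0 := by
    rw [measure_union_null_iff]
    exact ⟨hνQ, (measure_biUnion_null_iff N.countable_toSet).2 hnull⟩
  rw [h0, zero_add]
  refine (meas_ge_le_lintegral_div (Finset.measurable_sum E fun e _ => hmeas e).aemeasurable
    (by simpa using hn) (by simp)).trans ?_
  gcongr
  rw [lintegral_finsetSum _ fun e _ => hmeas e]
  simp only [hsq]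
  refine le_trans (le_of_eq ?_) (sum_le_seminormTrace p hE)
  rw [Finset.sum_map]; rfl

end Estimates

/-- The limit of representing measures on the subalgebras `cylAlg V F` represents `L`. -/
theorem isRepresentingRadon_of_tendsto {A : Type*} [CommRing A] [Algebra ℝ A]
    {V : Submodule ℝ A} (hV : Algebra.adjoin ℝ (V : Set A) = ⊤) {L : A →ₗ[ℝ] ℝ}
    {νF : ∀ F : Finset V, Measure (CharSpace (cylAlg V F))}
    (hνF : ∀ F, IsRepresentingRadon (L ∘ₗ (cylAlg V F).val.toLinearMap) (νF F))
    {u : Filter (Finset V)} [u.NeBot] (hu : u ≤ atTop) {ν : Measure (CharSpace A)}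
    [IsFiniteMeasure ν] [hreg : ν.InnerRegular]
    (hlim : ∀ f : C(ExtFun A, ℝ), Tendsto
      (fun F => ∫ β, f (ExtFun.ofSubalgebra _ β) ∂νF F) u (𝓝 (∫ α, f (ExtFun.ofChar α) ∂ν))) :
    IsRepresentingRadon L ν := by
  have key : ∀ a : A, Integrable (fun α : CharSpace A => α a) ν ∧ ∫ α, α a ∂ν = L a := by
    intro a
    have hev : ∀ᶠ F in u, a ∈ cylAlg V F := hu (eventually_mem_cylAlg hV a)
    -- Closed conditions on integrals of `φ ∘ clip M` survive the limit, because `φ ∘ clipE M` is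
    -- continuous on all of `EReal`.
    have hconv : ∀ (M : ℝ) (φ : ℝ → ℝ), Continuous φ → ∀ s : Set ℝ, IsClosed s →
        (∀ F (h : a ∈ cylAlg V F),
          ∫ β : CharSpace (cylAlg V F), φ (clip M (β ⟨a, h⟩)) ∂νF F ∈ s) →
        ∫ α : CharSpace A, φ (clip M (α a)) ∂ν ∈ s := by
      intro M φ hφ s hs hmem
      have h := hlim ⟨fun z => φ (clipE M (z a)),
        hφ.comp ((continuous_clipE M).comp (ExtFun.continuous_eval a))⟩
      simp only [ContinuousMap.coe_mk, ExtFun.ofChar, clipE_coe] at h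
      refine hs.mem_of_tendsto h (hev.mono fun F hF => ?_)
      simp only [ExtFun.ofSubalgebra_apply _ hF, clipE_coe]
      exact hmem F hF
    refine integrable_and_integral_eq_of_clip (c := L (a ^ 2))
      (CharSpace.continuous_eval a).measurable (fun n => ?_) fun n => ?_
    · exact hconv (n + 1 : ℕ) id continuous_id {x | |x - L a| ≤ L (a ^ 2) / (n + 1 : ℕ)}
        (isClosed_le (by fun_prop) continuous_const) fun F h =>
          (hνF F).abs_integral_clip_sub_le ⟨a, h⟩ (by positivity)
    · exact hconv n (· ^ 2) (continuous_pow 2) (Set.Iic (L (a ^ 2))) isClosed_Iic fun F h =>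
        (hνF F).integral_clip_sq_le ⟨a, h⟩ n.cast_nonneg
  exact ⟨inferInstance, hreg, fun a => (key a).1, fun a => (key a).2.symm⟩

end MomentProblem

theorem mainTheorem6 {A : Type*} [CommRing A] [Algebra ℝ A]
    (V : Submodule ℝ A) (hV : Algebra.adjoin ℝ (V : Set A) = ⊤)
    (K : Set (CharSpace A)) (hK : IsClosed K)
    (Q : Set A) (hQ : IsQuadraticModule Q) (hKQ : K = nonnegSet Q)
    (L : A →ₗ[ℝ] ℝ) (hL1 : L 1 = 1) (hL : IsSumSqPositive L)
    (q : Seminorm ℝ V) (hq : IsHilbertian q)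
    (htr : seminormTrace ((sL L hL).comp V.subtype) q < ⊤)
    (hne : (continuousPart V q K).Nonempty)
    (hS : ∀ S ∈ finGenSubalgebras V, ∃ νS : Measure (CharSpace S),
      IsRepresentingRadon (L ∘ₗ S.val.toLinearMap) νS ∧
        IsSupportedIn νS (nonnegSet {s : S | (s : A) ∈ Q})) :
    ∃ ν : Measure (CharSpace A),
      IsRepresentingRadon L ν ∧ IsSupportedIn ν (continuousPart V q K) := by
  classical
  open Filter Topology in
  subst hKQ
  choose νF hνF hνQ using fun F => hS _ (cylAlg_mem V F)
  have hprob : ∀ F, IsProbabilityMeasure (νF F) := fun F => (hνF F).isProbabilityMeasure hL1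
  have hιm : ∀ F, Measurable (ExtFun.ofSubalgebra (cylAlg V F)) := fun F =>
    (ExtFun.continuous_ofSubalgebra _).measurable
  let P : Finset V → ProbabilityMeasure (ExtFun A) := fun F =>
    ⟨(νF F).map (ExtFun.ofSubalgebra (cylAlg V F)),
      Measure.isProbabilityMeasure_map (hιm F).aemeasurable⟩
  obtain ⟨u, μ, hu, hμreg, hμfin, hlim⟩ := exists_regular_limit (l := atTop) P
  set T := seminormTrace ((sL L hL).comp V.subtype) q with hT
  have hball : ∀ n : ℕ, n ≠ 0 → μ (ExtFun.ofChar '' charBall V q Q n)ᶜ ≤ T / (n : ℝ≥0∞) ^ 2 := by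
    intro n hn
    refine (measure_mono (Set.compl_subset_compl.2
      (iInter_extending_cylBall_subset hV n))).trans
      (measure_compl_iInter_le hu hlim
        (fun F => ExtFun.isClosed_extending (isCompact_cylBall n F))
        (antitone_extending_cylBall n) fun F => ?_)
    refine le_trans ?_ (measure_compl_cylBall_le hq hL htr (hνF F) (hνQ F) hn)
    change (νF F).map (ExtFun.ofSubalgebra (cylAlg V F)) _ ≤ _
    rw [Measure.map_apply (hιm F)
      (ExtFun.isClosed_extending (isCompact_cylBall n F)).measurableSet.compl]
    exact measure_mono fun β hβ hβ' => hβ (ExtFun.ofSubalgebra_mem_extending hβ')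
  -- The bounds `T / n²` tend to `0` because `T` is finite.
  have hnull : μ (ExtFun.ofChar '' ⋃ n, charBall V q Q n)ᶜ = 0 := by
    have ht : Tendsto (fun n : ℕ => T / (n : ℝ≥0∞) ^ 2) atTop (𝓝 0) := by
      have h := ENNReal.Tendsto.const_div (a := T)
        (ENNReal.tendsto_nat_nhds_top.comp (tendsto_pow_atTop (α := ℕ) two_ne_zero))
        (Or.inr htr.ne)
      simpa using h
    refine le_antisymm (ge_of_tendsto ht ((eventually_ne_atTop 0).mono fun n hn => ?_)) bot_le
    refine (measure_mono (Set.compl_subset_compl.2 (Set.image_mono ?_))).trans (hball n hn)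
    exact Set.subset_iUnion (fun n => charBall V q Q n) n
  obtain ⟨ν, hνreg, hνmap, hνY⟩ := exists_innerRegular_map_eq ExtFun.isEmbedding_ofChar
    (fun n => isCompact_charBall (q := q) (Q := Q) hV n) hnull
  have hem : Measurable (ExtFun.ofChar : CharSpace A → ExtFun A) :=
    ExtFun.isEmbedding_ofChar.continuous.measurable
  have hνfin : IsFiniteMeasure ν := by
    refine ⟨?_⟩
    rw [← Set.preimage_univ (f := ExtFun.ofChar), ← Measure.map_apply hem MeasurableSet.univ, hνmap]
    exact measure_lt_top μ _
  refine ⟨ν, isRepresentingRadon_of_tendsto hV hνF hu fun f => ?_,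
    measure_mono_null (Set.compl_subset_compl.2 (Set.iUnion_subset charBall_subset_continuousPart)) hνY⟩
  have h := hlim f
  rw [← hνmap, integral_map hem.aemeasurable f.continuous.aestronglyMeasurable] at h
  refine h.congr fun F => ?_
  exact integral_map (hιm F).aemeasurable f.continuous.aestronglyMeasurable
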